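/- **Setting.** A *Büchi bidding game* consists of a finite directed graph $(V,E)$, $V\neq\emptyset$, in which every vertex has a neighbour, a sum of budgets $k\in\mathbb N$, and a set $F\subseteq V$ of accepting vertices. Budgets and bids are elements of $\mathbb N^*=\{0<0^*<1<1^*<\dots\}$, where $m^*$ means the amount $m$ together with the advantage; put $|m|=|m^*|=m$ and $[k]=\{0,0^*,\dots,k,k^*\}$. A configuration $\langle v,B\rangle\in V\times[k]$ gives the position of the token and Player 1's budget; Player 2 has the amount $k-|B|$, and has the advantage iff Player 1 has not. In each turn both players simultaneously choose a bid not exceeding their amount (which may include the advantage only if they hold it) and a neighbour of the current vertex. The higher bidder moves the token to the chosen neighbour and pays the bid (with the advantage, if included) to the opponent; in a tie, the player who holds the advantage loses the bidding and keeps the advantage. Strategies are functions of the history. A function $T:V\to[k]\cup\{k+1\}$ is the *threshold* for an objective $\mathcal O\subseteq V^\omega$ if for every $\langle v,B\rangle$: if $B\ge T(v)$, Player 1 has a strategy that ensures $\mathcal O$ against every strategy of Player 2; and if $B<T(v)$, Player 2 has a strategy that ensures the complement of $\mathcal O$ against every strategy of Player 1. Player 1 is the co-Büchi player, whose objective is that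 $F$ is visited only finitely often; let $\text{coBü-Th}$ be the threshold for it. For $i\ge 0$, the objective $\text{Safe}_i$ consists of the paths that visit $F$ only finitely often and that either start in $V\setminus F$ and enter $F$ at most $i$ times, or start in $F$, exit $F$, and enter $F$ at most $i-1$ more times (no path that starts in $F$ is in $\text{Safe}_0$). Let $\text{Th}_i$ be the threshold for $\text{Safe}_i$. A function $T:V\to[k]\cup\{k+1\}$ has the *average property* if for every $v\in V$, with $v^+$ and $v^-$ neighbours of $v$ of maximal and minimal value under $T$, $$T(v)=\left\lfloor\frac{|T(v^+)|+|T(v^-)|}{2}\right\rfloor+\varepsilon,$$ where $\varepsilon=0$ if $|T(v^+)|+|T(v^-)|$ is even and $T(v^-)\in\mathbb N$; $\varepsilon=1$ if $|T(v^+)|+|T(v^-)|$ is odd and $T(v^-)\notin\mathbb N$; and $\varepsilon=*$ (the advantage is added) otherwise. **Theorem.** In every Büchi bidding game the thresholds $\text{Th}_i$ ($i\ge0$) and $\text{coBü-Th}$ exist and are unique, $\text{Th}_{i+1}\le\text{Th}_i$ for all $i$, and there is $n$ with $\text{Th}_n=\text{Th}_{n+1}$. For every such $n$, $\text{Th}_n=\text{coBü-Th}$,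 and this function has the average property. Moreover, it is computed in $O\big((|V|\cdot\max(k,1))^2\big)$ steps, with an absolute constant, by the following fixed-point algorithm. The algorithm alternately computes the thresholds of Player 1 (i) outside $F$, for avoiding $F$ or reaching each $u\in F$ with at least the budget currently assigned to $u$, and (ii) in $F$, for reaching $V\setminus F$ at some $v$ with at least the budget currently assigned to $v$. It starts with (i) and the budget $k+1$ on $F$, and halts when two consecutive results of (i) coincide. Each computation (i), (ii) updates a table by averaging, increasing from $0$ in (i) and decreasing from $k+1$ in (ii), with a queue that initially holds all vertices. One step takes one vertex $u$ from the queue, re-evaluates the right-hand side of the average property at the predecessors of $u$ that lie in the part being computed, and appends the vertices whose value has changed; the passage from one computation to the next is also one step. -/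

import Mathlib

namespace Bidding

/-- A budget or a bid: an amount together with the information whether it includes the advantage.
`⟨m, false⟩` is the plain number `m`, and `⟨m, true⟩` is `m*`. -/
structure Budget where
  /-- the integer part `|m*| = m` -/
  val : ℕ
  /-- is the advantage included? -/
  adv : Bool

namespace Budget

/-- The position of a budget in the order `0 < 0* < 1 < 1* < 2 < …`. -/
def code (b : Budget) : ℕ := 2 * b.val + b.adv.toNat

theorem code_injective : Function.Injective code := by
  rintro ⟨m, a⟩ ⟨n, b⟩ h
  cases a <;> cases b <;> simp [code] at h ⊢ <;> omega

/-- The order `0 < 0* < 1 < 1* < 2 < …`. -/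
instance : LinearOrder Budget := LinearOrder.lift' code code_injective

/-- `x ⊕ y`; at most one of the two arguments holds the advantage in a play. -/
def plus (x y : Budget) : Budget := ⟨x.val + y.val, x.adv || y.adv⟩

/-- `x ⊖ y`; in a play `y ≤ x`, and `y` includes the advantage only if `x` does. -/
def minus (x y : Budget) : Budget := ⟨x.val - y.val, x.adv && !y.adv⟩

/-- The value that the average property prescribes at a vertex whose largest and smallest neighbour
values are `hi` and `lo`: the floor of `(|hi| + |lo|) / 2`, plus `0`, `1`, or the advantage. -/
def average (hi lo : Budget) : Budget :=
  if Even (hi.val + lo.val) ∧ lo.adv = false then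
    ⟨(hi.val + lo.val) / 2, false⟩
  else if Odd (hi.val + lo.val) ∧ lo.adv = true then
    ⟨(hi.val + lo.val) / 2 + 1, false⟩
  else
    ⟨(hi.val + lo.val) / 2, true⟩

end Budget

/-- A Büchi bidding game: a directed graph in which every vertex has a neighbour, the sum `k` of the
budgets of the two players, and the set `F` of accepting vertices. Player 1 is the co-Büchi player,
Player 2 the Büchi player. -/
structure BuchiGame (V : Type*) where
  E : Finset (V × V)
  k : ℕ
  F : Finset V
  exists_edge : ∀ v, ∃ u, (v, u) ∈ E

/-- A configuration: the vertex of the token and the budget of Player 1. -/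
structure Config (V : Type*) where
  vertex : V
  budget : Budget

/-- An action: a bid, and the vertex to move to upon winning the bidding. -/
structure Action (V : Type*) where
  bid : Budget
  target : V

/-- A strategy maps the past (the configurations and joint actions so far) and the current
configuration to an action. -/
abbrev Strategy (V : Type*) := List (Config V × Action V × Action V) → Config V → Action V

namespace BuchiGame

variable {V : Type*}

/-! ### The concurrent game -/

/-- A player with budget `B` may bid at most `B`, may include the advantage only when holding it,
and moves along an edge. -/
def Allowed (G : BuchiGame V) (v : V) (B : Budget) (a : Action V) : Prop :=
  a.bid.val ≤ B.val ∧ (a.bid.adv = true → B.adv = true) ∧ (v, a.target) ∈ G.E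

/-- Player 2's budget `k* ⊖ B`, when Player 1's budget is `B`. -/
def budget₂ (G : BuchiGame V) (B : Budget) : Budget := Budget.minus ⟨G.k, true⟩ B

/-- The transition function. The higher bidder moves and pays the bid to the other player. In a
tie, the player with the advantage has not used it, loses the bidding, and keeps the advantage. -/
def next (c : Config V) (a₁ a₂ : Action V) : Config V :=
  if a₂.bid < a₁.bid then ⟨a₁.target, c.budget.minus a₁.bid⟩
  else if a₁.bid < a₂.bid then ⟨a₂.target, c.budget.plus a₂.bid⟩
  else if c.budget.adv = true then ⟨a₂.target, c.budget.plus a₂.bid⟩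
  else ⟨a₁.target, c.budget.minus a₁.bid⟩

def Legal₁ (G : BuchiGame V) (f : Strategy V) : Prop :=
  ∀ h c, G.Allowed c.vertex c.budget (f h c)

def Legal₂ (G : BuchiGame V) (g : Strategy V) : Prop :=
  ∀ h c, G.Allowed c.vertex (G.budget₂ c.budget) (g h c)

/-- The history after `n` turns: its past, and its last configuration. -/
def history (f g : Strategy V) (c : Config V) :
    ℕ → List (Config V × Action V × Action V) × Config V
  | 0 => ([], c)
  | n + 1 =>
    let h := (history f g c n).1
    let q := (history f g c n).2
    (h ++ [(q, f h q, g h q)], next q (f h q) (g h q))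

/-- The infinite path of vertices that a play traverses. -/
def play (f g : Strategy V) (c : Config V) (n : ℕ) : V := (history f g c n).2.vertex

def Wins₁ (G : BuchiGame V) (O : Set (ℕ → V)) (c : Config V) : Prop :=
  ∃ f, G.Legal₁ f ∧ ∀ g, G.Legal₂ g → play f g c ∈ O

def Wins₂ (G : BuchiGame V) (O : Set (ℕ → V)) (c : Config V) : Prop :=
  ∃ g, G.Legal₂ g ∧ ∀ f, G.Legal₁ f → play f g c ∉ O

/-- The value `k + 1`, a budget that Player 1 never has. -/
def top (G : BuchiGame V) : Budget := ⟨G.k + 1, false⟩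

/-- `T : V → {0, 0*, …, k, k*, k + 1}` gives the threshold budgets of Player 1 for the
objective `O`. -/
def IsThreshold (G : BuchiGame V) (O : Set (ℕ → V)) (T : V → Budget) : Prop :=
  (∀ v, T v ≤ G.top) ∧
  ∀ v B, B.val ≤ G.k →
    (T v ≤ B → G.Wins₁ O ⟨v, B⟩) ∧ (B < T v → G.Wins₂ O ⟨v, B⟩)

/-! ### Objectives -/

/-- `F` is visited only finitely often. -/
def CoBuchi (G : BuchiGame V) : Set (ℕ → V) := {π | {j | π j ∈ G.F}.Finite}

/-- The times at which a path enters `F` (shifted by one). -/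
def entries (G : BuchiGame V) (π : ℕ → V) : Set ℕ := {j | π j ∉ G.F ∧ π (j + 1) ∈ G.F}

/-- The paths that visit `F` only finitely often and that either start outside `F` and enter `F` at
most `i` times, or start in `F`, exit `F`, and enter `F` at most `i - 1` more times (which is
impossible for `i = 0`). -/
def Safe (G : BuchiGame V) (i : ℕ) : Set (ℕ → V) :=
  {π | π ∈ G.CoBuchi ∧
    ((π 0 ∉ G.F ∧ (G.entries π).encard ≤ i) ∨
      (π 0 ∈ G.F ∧ (∃ j, π j ∈ G.F ∧ π (j + 1) ∉ G.F) ∧ (G.entries π).encard + 1 ≤ i))}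

/-! ### The average property -/

variable [Fintype V] [DecidableEq V]

/-- The neighbours of `v`. -/
def nbrs (G : BuchiGame V) (v : V) : Finset V := Finset.univ.filter fun u => (v, u) ∈ G.E

theorem nbrs_nonempty (G : BuchiGame V) (v : V) : (G.nbrs v).Nonempty := by
  obtain ⟨u, hu⟩ := G.exists_edge v
  exact ⟨u, by simpa [nbrs] using hu⟩

/-- The average of the largest and the smallest value of `T` among the neighbours of `v`. -/
def avg (G : BuchiGame V) (T : V → Budget) (v : V) : Budget :=
  Budget.average ((G.nbrs v).sup' (G.nbrs_nonempty v) T) ((G.nbrs v).inf' (G.nbrs_nonempty v) T)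

def HasAverageProperty (G : BuchiGame V) (T : V → Budget) : Prop := ∀ v, T v = G.avg T v

/-! ### The algorithm

The algorithm alternates between two kinds of phases. In both, a table `T` is updated until it
satisfies the average property outside a set `S` of sinks, where it stays equal to given frugal
target budgets. In a *reach* phase `S = V \ F`, and `T` decreases from `k + 1` on `F`. In an
*avoid* phase `S = F`, and `T` increases from `0` on `V \ F`. The queue holds the vertices whose
current value has not been propagated yet. The list `order` enumerates the vertices. -/

/-- Re-average `T` at those predecessors of `u` that are not sinks. -/
def relax (G : BuchiGame V) (S : Finset V) (T : V → Budget) (u : V) : V → Budget :=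
  fun w => if w ∉ S ∧ (w, u) ∈ G.E then G.avg T w else T w

/-- The vertices at which two tables differ. -/
def changed (order : List V) (T T' : V → Budget) : List V :=
  order.filter fun w => T w ≠ T' w

/-- The state of the algorithm. `prev` is the table that the previous avoid phase has returned. -/
inductive State (V : Type*) where
  | avoid (prev : Option (V → Budget)) (T : V → Budget) (queue : List V)
  | reach (prev : V → Budget) (T : V → Budget) (queue : List V)
  | halted (T : V → Budget)

/-- Start of an avoid phase, in which the sinks `F` have target budgets `fr`. -/
def startAvoid (G : BuchiGame V) (order : List V) (prev : Option (V → Budget))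
    (fr : V → Budget) : State V :=
  .avoid prev (fun v => if v ∈ G.F then fr v else ⟨0, false⟩) order

/-- Start of a reach phase, in which the sinks `V \ F` have target budgets `fr`. -/
def startReach (G : BuchiGame V) (order : List V) (fr : V → Budget) : State V :=
  .reach fr (fun v => if v ∈ G.F then G.top else fr v) order

/-- The initial state: an avoid phase, in which `F` must not be visited at all. -/
def start (G : BuchiGame V) (order : List V) : State V :=
  G.startAvoid order none fun _ => G.top

/-- One step of the algorithm: take one vertex from the queue and propagate its value to its
predecessors, or, when the queue is empty, pass to the next phase. The algorithm halts when two
consecutive avoid phases return the same table. -/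
def step (G : BuchiGame V) (order : List V) : State V → State V
  | .avoid prev T (u :: q) =>
    .avoid prev (G.relax G.F T u) (q ++ changed order T (G.relax G.F T u))
  | .avoid prev T [] =>
    if prev = some T then .halted T else G.startReach order T
  | .reach prev T (u :: q) =>
    .reach prev (G.relax G.Fᶜ T u) (q ++ changed order T (G.relax G.Fᶜ T u))
  | .reach prev T [] => G.startAvoid order (some prev) T
  | .halted T => .halted T

/-- The state after `t` steps. -/
def stateAfter (G : BuchiGame V) (order : List V) (t : ℕ) : State V :=
  (G.step order)^[t] (G.start order)

end BuchiGame

end Bidding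

namespace Bidding

/-! ### Arithmetic of budgets and of the two optimal bids -/

namespace Budget

/-! A single turn is determined, and the average is its threshold. If the table `T` states how much
Player 1 needs after the turn, then at `v` a budget of at least `G.avg T v` suffices to meet `T`,
and a smaller one lets Player 2 push Player 1 below `T`. Player 1 bids what can be spared above the
smallest neighbour value and moves there; Player 2 bids as much as can be paid without lifting
Player 1 to the largest one (`exists_bid₁`, `exists_bid₂`).

Averaging is monotone, so iterating it outside a set of sinks, up from `0` or down from `k + 1`,
becomes stationary after at most `|V| (2k + 2)` rounds. The iterates serve as ranks: descending, the
`n`-th one gives budgets that force a sink within `n` turns; ascending, a Player 1 below the `n`-th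
one can be forced into a sink, below its target, within `n` turns.

The tables `thr i` nest the two iterations. To win `Safe (i + 1)` from `F`, Player 1 must leave `F`
with the budget for `Safe i`; outside `F`, Player 1 must stay there or enter `F` with the budget
just computed. Both players play positionally for the best level and rank that the current
configuration offers. Combinatorial lemmas on paths turn the decrease of levels and ranks into the
objectives (`mem_safe_of_levels`, `Losing.notMem_safe`). The tables decrease with `i`, so they
stabilize. At a fixed point leaving `F` no longer costs Player 2 a level, so `F` is visited
infinitely often (`Losing.notMem_coBuchi`), while Player 1 wins because `Safe n` lies in `CoBuchi`.

The queue algorithm computes the same limits in a different order of updates. Its cost per phase is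
bounded by the queue length plus the total rank of the table. -/

theorem le_iff {x y : Budget} : x ≤ y ↔ x.code ≤ y.code := Iff.rfl

theorem lt_iff {x y : Budget} : x < y ↔ x.code < y.code := Iff.rfl

/-- The case distinction for `ε` is what makes the average linear in codes, with no rounding left.
The advantage of `hi` plays no role. -/
theorem code_average (hi lo : Budget) :
    (average hi lo).code = hi.val + lo.val + lo.adv.toNat := by
  rcases hi with ⟨m, a⟩
  rcases lo with ⟨n, b⟩
  rcases Nat.even_or_odd (m + n) with h | h
  · have h' : ¬ Odd (m + n) := by simpa using h
    cases b <;> simp [average, code, h, h'] <;> grind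
  · have h' : ¬ Even (m + n) := by simpa using h
    cases b <;> simp [average, code, h, h'] <;> grind

theorem average_mono {h h' l l' : Budget} (hh : h ≤ h') (hl : l ≤ l') :
    average h l ≤ average h' l' := by
  rw [le_iff] at *
  rw [code_average, code_average]
  rcases h with ⟨_, _ | _⟩ <;> rcases h' with ⟨_, _ | _⟩ <;> rcases l with ⟨_, _ | _⟩ <;>
    rcases l' with ⟨_, _ | _⟩ <;> simp [code] at * <;> omega

theorem average_le {h l : Budget} (hl : l ≤ h) : average h l ≤ h := by
  rw [le_iff] at *
  rw [code_average]
  rcases h with ⟨_, _ | _⟩ <;> rcases l with ⟨_, _ | _⟩ <;> simp [code] at * <;> omega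

/-- A bid at budget `b` that leaves at least `l` upon winning the bidding. -/
def bidAbove (b l : Budget) : Budget :=
  ⟨b.val - l.val - (l.adv && !b.adv).toNat, b.adv && !l.adv⟩

/-- A bid against budget `b` that leaves less than `h` when it is paid to the opponent. -/
def bidBelow (b h : Budget) : Budget :=
  ⟨h.val - b.val - (b.adv || !h.adv).toNat, !b.adv && !h.adv⟩

theorem le_minus_bidAbove {b h l : Budget} (hl : l ≤ h) (hb : average h l ≤ b) :
    l ≤ b.minus (bidAbove b l) := by
  rw [le_iff] at *
  rw [code_average] at hb
  rcases b with ⟨_, _ | _⟩ <;> rcases h with ⟨_, _ | _⟩ <;> rcases l with ⟨_, _ | _⟩ <;>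
    simp [code, minus, bidAbove] at * <;> omega

/-- The bid is about `b - l`, so an opponent who outbids it pays at least that much and lifts Player
1 to `2b - l ≥ h`. A tie is lost only with the advantage, which supplies the missing half unit. -/
theorem le_plus_of_bidAbove {b h l y : Budget} (hl : l ≤ h) (hb : average h l ≤ b)
    (hy : y.adv = true → b.adv = false)
    (hlt : bidAbove b l < y ∨ (b.adv = true ∧ bidAbove b l ≤ y)) :
    h ≤ b.plus y := by
  rw [le_iff] at *
  rw [lt_iff] at hlt
  rw [code_average] at hb
  rcases b with ⟨_, _ | _⟩ <;> rcases h with ⟨_, _ | _⟩ <;> rcases l with ⟨_, _ | _⟩ <;>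
    rcases y with ⟨_, _ | _⟩ <;> simp [code, plus, bidAbove] at * <;> omega

theorem plus_bidBelow_lt {b h l : Budget} (hl : l ≤ h) (hb : b < average h l) :
    b.plus (bidBelow b h) < h := by
  rw [le_iff] at hl
  rw [lt_iff] at *
  rw [code_average] at hb
  rcases b with ⟨_, _ | _⟩ <;> rcases h with ⟨_, _ | _⟩ <;> rcases l with ⟨_, _ | _⟩ <;>
    simp [code, plus, bidBelow] at * <;> omega

/-- Mirror image of `le_plus_of_bidAbove`: whoever outbids about `h - b` falls to `2b - h`, which is
below `l`. -/
theorem minus_lt_of_bidBelow {b h l x : Budget} (hl : l ≤ h) (hb : b < average h l)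
    (hx : x.adv = true → b.adv = true) (hxb : x.val ≤ b.val)
    (hlt : bidBelow b h < x ∨ (b.adv = false ∧ bidBelow b h ≤ x)) :
    b.minus x < l := by
  rw [le_iff] at hl
  rw [lt_iff] at *
  rw [le_iff] at hlt
  rw [code_average] at hb
  rcases b with ⟨_, _ | _⟩ <;> rcases h with ⟨_, _ | _⟩ <;> rcases l with ⟨_, _ | _⟩ <;>
    rcases x with ⟨_, _ | _⟩ <;> simp [code, minus, bidBelow] at * <;> omega

end Budget

namespace BuchiGame

section

variable {V : Type*} (G : BuchiGame V)

/-! ### Budgets along a play, and uniqueness of thresholds -/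

theorem lt_top_iff {b : Budget} : b < G.top ↔ b.val ≤ G.k := by
  rcases b with ⟨m, _ | _⟩ <;> simp [Budget.lt_iff, Budget.code, top]; all_goals omega

theorem next_budget_le {c : Config V} {a₁ a₂ : Action V} (hc : c.budget.val ≤ G.k)
    (h₂ : G.Allowed c.vertex (G.budget₂ c.budget) a₂) : (next c a₁ a₂).budget.val ≤ G.k := by
  have := h₂.1
  simp only [next, budget₂, Budget.minus, Budget.plus] at *
  split_ifs <;> simp <;> omega

theorem history_budget_le {f g : Strategy V} (hg : G.Legal₂ g) {c : Config V}
    (hc : c.budget.val ≤ G.k) (t : ℕ) : (history f g c t).2.budget.val ≤ G.k := by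
  induction t with
  | zero => exact hc
  | succ t ih => exact G.next_budget_le ih (hg _ _)

theorem IsThreshold.unique {O : Set (ℕ → V)} {T T' : V → Budget} (h : G.IsThreshold O T)
    (h' : G.IsThreshold O T') : T = T' := by
  suffices H : ∀ T T' : V → Budget, G.IsThreshold O T → G.IsThreshold O T' → ∀ v, T' v ≤ T v from
    funext fun v => le_antisymm (H _ _ h' h v) (H _ _ h h' v)
  intro T T' h h' v
  by_contra! hlt
  -- The smaller value `T v` is a genuine budget. At it both players would win, and their winning
  -- strategies played against each other give a contradiction.
  have hk : (T v).val ≤ G.k := G.lt_top_iff.1 (hlt.trans_le (h'.1 v))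
  obtain ⟨f, hf, hw⟩ := (h.2 v _ hk).1 le_rfl
  obtain ⟨g, hg, hw'⟩ := (h'.2 v _ hk).2 hlt
  exact hw' f hf (hw g hg)

variable [Fintype V] [DecidableEq V]

/-! ### The average of the neighbours -/

theorem mem_nbrs {v u : V} : u ∈ G.nbrs v ↔ (v, u) ∈ G.E := by simp [nbrs]

theorem exists_avg_eq (T : V → Budget) (v : V) : ∃ hi lo, (v, hi) ∈ G.E ∧ (v, lo) ∈ G.E ∧
    (∀ u, (v, u) ∈ G.E → T lo ≤ T u ∧ T u ≤ T hi) ∧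
    G.avg T v = Budget.average (T hi) (T lo) := by
  obtain ⟨hi, hhi, ehi⟩ := Finset.exists_mem_eq_sup' (G.nbrs_nonempty v) T
  obtain ⟨lo, hlo, elo⟩ := Finset.exists_mem_eq_inf' (G.nbrs_nonempty v) T
  refine ⟨hi, lo, G.mem_nbrs.1 hhi, G.mem_nbrs.1 hlo, fun u hu => ⟨?_, ?_⟩, ?_⟩
  · rw [← elo]
    exact Finset.inf'_le _ (G.mem_nbrs.2 hu)
  · rw [← ehi]
    exact Finset.le_sup' _ (G.mem_nbrs.2 hu)
  · rw [avg, ehi, elo]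

theorem avg_mono {T T' : V → Budget} {v : V} (h : ∀ u, (v, u) ∈ G.E → T u ≤ T' u) :
    G.avg T v ≤ G.avg T' v :=
  Budget.average_mono
    (Finset.sup'_le _ _ fun u hu => (h u (G.mem_nbrs.1 hu)).trans (Finset.le_sup' _ hu))
    (Finset.le_inf' _ _ fun u hu => (Finset.inf'_le _ hu).trans (h u (G.mem_nbrs.1 hu)))

theorem avg_congr {T T' : V → Budget} {v : V} (h : ∀ u, (v, u) ∈ G.E → T u = T' u) :
    G.avg T v = G.avg T' v :=
  le_antisymm (G.avg_mono fun u hu => (h u hu).le) (G.avg_mono fun u hu => (h u hu).ge)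

theorem avg_le {T : V → Budget} {v : V} {b : Budget} (h : ∀ u, T u ≤ b) : G.avg T v ≤ b := by
  obtain ⟨hi, lo, hhi, -, hT, e⟩ := G.exists_avg_eq T v
  rw [e]
  exact (Budget.average_le (hT hi hhi).1).trans (h hi)

/-! ### One turn of the game -/

/-- Legality does not depend on the budget sufficing, so these actions assemble into a legal
strategy defined at every configuration. -/
theorem exists_bid₁ (T : V → Budget) (c : Config V) : ∃ a₁, G.Allowed c.vertex c.budget a₁ ∧
    (G.avg T c.vertex ≤ c.budget → ∀ a₂, G.Allowed c.vertex (G.budget₂ c.budget) a₂ →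
      T (next c a₁ a₂).vertex ≤ (next c a₁ a₂).budget) := by
  obtain ⟨hi, lo, hhi, hlo, hT, e⟩ := G.exists_avg_eq T c.vertex
  refine ⟨⟨c.budget.bidAbove (T lo), lo⟩, ⟨?_, ?_, hlo⟩, fun hb a₂ ha₂ => ?_⟩
  · simp only [Budget.bidAbove]
    omega
  · simp +contextual [Budget.bidAbove]
  · rw [e] at hb
    have hw := Budget.le_minus_bidAbove (hT hi hhi).1 hb
    have hl : ∀ _ : _, T a₂.target ≤ c.budget.plus a₂.bid := fun h =>
      (hT _ ha₂.2.2).2.trans (Budget.le_plus_of_bidAbove (hT hi hhi).1 hb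
        (fun h => by simpa [budget₂, Budget.minus] using ha₂.2.1 h) h)
    unfold next
    split_ifs with h₁ h₂ h₃
    · exact hw
    · exact hl (.inl h₂)
    · exact hl (.inr ⟨h₃, not_lt.1 h₁⟩)
    · exact hw

theorem exists_bid₂ (T : V → Budget) (hT : ∀ u, T u ≤ G.top) (c : Config V) :
    ∃ a₂, G.Allowed c.vertex (G.budget₂ c.budget) a₂ ∧
    (c.budget < G.avg T c.vertex → ∀ a₁, G.Allowed c.vertex c.budget a₁ →
      (next c a₁ a₂).budget < T (next c a₁ a₂).vertex) := by
  obtain ⟨hi, lo, hhi, hlo, hT', e⟩ := G.exists_avg_eq T c.vertex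
  refine ⟨⟨c.budget.bidBelow (T hi), hi⟩, ⟨?_, ?_, hhi⟩, fun hb a₁ ha₁ => ?_⟩
  · have := hT hi
    rw [Budget.le_iff] at this
    generalize T hi = h at this
    rcases h with ⟨_, _ | _⟩ <;>
      simp [Budget.bidBelow, budget₂, Budget.minus, Budget.code, top] at * <;> omega
  · simp +contextual [Budget.bidBelow, budget₂, Budget.minus]
  · rw [e] at hb
    have hw := Budget.plus_bidBelow_lt (hT' hi hhi).1 hb
    have hl : ∀ _ : _, c.budget.minus a₁.bid < T a₁.target := fun h =>
      (Budget.minus_lt_of_bidBelow (hT' hi hhi).1 hb ha₁.2.1 ha₁.1 h).trans_le (hT' _ ha₁.2.2).1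
    unfold next
    split_ifs with h₁ h₂ h₃
    · exact hl (.inl h₁)
    · exact hw
    · exact hw
    · exact hl (.inr ⟨by simpa using h₃, not_lt.1 h₂⟩)

/-! ### Positional strategies -/

/-- Player 1 can, at every configuration `c`, aim for the table `τ c`. -/
theorem exists_strategy₁ (τ : Config V → V → Budget) : ∃ f, G.Legal₁ f ∧ ∀ g, G.Legal₂ g →
    ∀ c t, G.avg (τ (history f g c t).2) (history f g c t).2.vertex ≤ (history f g c t).2.budget →
      τ (history f g c t).2 (history f g c (t + 1)).2.vertex ≤
        (history f g c (t + 1)).2.budget := by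
  choose a ha hw using fun c => G.exists_bid₁ (τ c) c
  exact ⟨fun _ c => a c, fun _ c => ha c, fun g hg c t h => hw _ h _ (hg _ _)⟩

/-- Player 2 can, at every configuration `c`, aim for staying below the table `τ c`. -/
theorem exists_strategy₂ (τ : Config V → V → Budget) (hτ : ∀ c u, τ c u ≤ G.top) :
    ∃ g, G.Legal₂ g ∧ ∀ f, G.Legal₁ f →
    ∀ c t, (history f g c t).2.budget < G.avg (τ (history f g c t).2) (history f g c t).2.vertex →
      (history f g c (t + 1)).2.budget <
        τ (history f g c t).2 (history f g c (t + 1)).2.vertex := by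
  choose a ha hw using fun c => G.exists_bid₂ (τ c) (hτ c) c
  exact ⟨fun _ c => a c, fun _ c => ha c, fun f hf c t h => hw _ h _ (hf _ _)⟩

end

section

variable {V : Type*} [Fintype V] [DecidableEq V] (G : BuchiGame V)

/-! ### Iterated averaging outside a set of sinks -/

/-- The `n`-th table obtained from `T₀` by averaging simultaneously outside the sinks `S`. -/
def iter (S : Finset V) (T₀ : V → Budget) : ℕ → V → Budget
  | 0 => T₀
  | n + 1 => fun v => if v ∈ S then T₀ v else G.avg (iter S T₀ n) v

/-- The table at which iterated averaging becomes stationary. -/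
def limit (S : Finset V) (T₀ : V → Budget) : V → Budget :=
  G.iter S T₀ (Fintype.card V * (2 * G.k + 2))

theorem iter_of_mem {S : Finset V} (T₀ : V → Budget) {v : V} (hv : v ∈ S) (n : ℕ) :
    G.iter S T₀ n v = T₀ v := by
  cases n <;> simp [iter, hv]

theorem iter_succ_of_notMem {S : Finset V} (T₀ : V → Budget) {v : V} (hv : v ∉ S) (n : ℕ) :
    G.iter S T₀ (n + 1) v = G.avg (G.iter S T₀ n) v := by
  simp [iter, hv]

theorem limit_of_mem {S : Finset V} (T₀ : V → Budget) {v : V} (hv : v ∈ S) :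
    G.limit S T₀ v = T₀ v := G.iter_of_mem T₀ hv _

theorem iter_le_top {S : Finset V} {T₀ : V → Budget} (h : ∀ v, T₀ v ≤ G.top) (n : ℕ) (v : V) :
    G.iter S T₀ n v ≤ G.top := by
  induction n generalizing v with
  | zero => exact h v
  | succ n ih =>
    by_cases hv : v ∈ S
    · rw [iter_of_mem _ _ hv]
      exact h v
    · rw [iter_succ_of_notMem _ _ hv]
      exact G.avg_le ih

theorem iter_mono {S : Finset V} {T₀ T₁ : V → Budget} (h : ∀ v, T₀ v ≤ T₁ v) (n : ℕ) (v : V) :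
    G.iter S T₀ n v ≤ G.iter S T₁ n v := by
  induction n generalizing v with
  | zero => exact h v
  | succ n ih =>
    by_cases hv : v ∈ S
    · simpa only [iter_of_mem _ _ hv] using h v
    · simpa only [iter_succ_of_notMem _ _ hv] using G.avg_mono fun u _ => ih u

/-- An order on budgets in which averaging is monotone, with a rank that strictly decreases along
it. The two instances are `≤` and `≥`. -/
structure Direction (r : Budget → Budget → Prop) (rank : Budget → ℕ) : Prop where
  refl : ∀ x, r x x
  trans : ∀ {x y z}, r x y → r y z → r x z
  antisymm : ∀ {x y}, r x y → r y x → x = y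
  avg : ∀ {T T' : V → Budget} (v : V), (∀ u, r (T u) (T' u)) → r (G.avg T v) (G.avg T' v)
  rank_lt : ∀ {x y}, x ≤ G.top → y ≤ G.top → r x y → x ≠ y → rank y < rank x
  rank_le : ∀ x, rank x ≤ 2 * G.k + 2 ∨ G.top < x

theorem direction_le : G.Direction (· ≤ ·) fun x => 2 * G.k + 2 - x.code where
  refl := le_refl
  trans := le_trans
  antisymm := le_antisymm
  avg _ h := G.avg_mono fun u _ => h u
  rank_lt {x y} hx hy h hne := by
    have := h.lt_of_ne hne
    rw [Budget.le_iff] at hx hy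
    rw [Budget.lt_iff] at this
    simp only [top, Budget.code, Bool.toNat_false] at *
    omega
  rank_le x := .inl (by omega)

theorem direction_ge : G.Direction (· ≥ ·) Budget.code where
  refl := le_refl
  trans h h' := le_trans h' h
  antisymm h h' := le_antisymm h' h
  avg _ h := G.avg_mono fun u _ => h u
  rank_lt hx hy h hne := Budget.lt_iff.1 (lt_of_le_of_ne h hne.symm)
  rank_le x := by
    rw [Budget.lt_iff]
    simp only [top, Budget.code, Bool.toNat_false]
    omega

/-- A potential that starts at `N` or less cannot drop `N + 1` times. -/
theorem exists_succ_eq_of_potential {α : Type*} (T : ℕ → α) (f : ℕ → ℕ) {N : ℕ} (h₀ : f 0 ≤ N)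
    (h : ∀ n, T n ≠ T (n + 1) → f (n + 1) < f n) : ∃ n ≤ N, T n = T (n + 1) := by
  by_contra! hne
  have key : ∀ n ≤ N + 1, f n + n ≤ N := by
    intro n
    induction n with
    | zero => simpa using h₀
    | succ n ih =>
      intro hn
      have h₁ := h n (hne n (by omega))
      have h₂ := ih (by omega)
      omega
  have := key (N + 1) le_rfl
  omega

/-! ### Convergence of the iteration, and correctness of the queue, in both directions at once -/

namespace Direction

variable {G} {r : Budget → Budget → Prop} {rank : Budget → ℕ} (d : G.Direction r rank)
include d

theorem rank_le_of_le {x : Budget} (hx : x ≤ G.top) : rank x ≤ 2 * G.k + 2 :=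
  (d.rank_le x).resolve_right hx.not_gt

theorem sum_rank_le {T : V → Budget} (hT : ∀ v, T v ≤ G.top) :
    ∑ v, rank (T v) ≤ Fintype.card V * (2 * G.k + 2) := by
  simpa using Finset.sum_le_card_nsmul Finset.univ _ _ fun v _ => d.rank_le_of_le (hT v)

theorem rank_add_le {x y : Budget} (hx : x ≤ G.top) (hy : y ≤ G.top) (h : r x y) :
    rank y + (if x ≠ y then 1 else 0) ≤ rank x := by
  split_ifs with hne
  · exact d.rank_lt hx hy h hne
  · simp [not_not.1 hne]

theorem sum_rank_add_card_le {T T' : V → Budget} (hT : ∀ v, T v ≤ G.top)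
    (hT' : ∀ v, T' v ≤ G.top) (h : ∀ v, r (T v) (T' v)) :
    ∑ v, rank (T' v) + (Finset.univ.filter fun v => T v ≠ T' v).card ≤ ∑ v, rank (T v) := by
  rw [Finset.card_filter, ← Finset.sum_add_distrib]
  exact Finset.sum_le_sum fun v _ => d.rank_add_le (hT v) (hT' v) (h v)

theorem sum_rank_lt {T T' : V → Budget} (hT : ∀ v, T v ≤ G.top)
    (hT' : ∀ v, T' v ≤ G.top) (h : ∀ v, r (T v) (T' v)) (hne : T ≠ T') :
    ∑ v, rank (T' v) < ∑ v, rank (T v) := by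
  obtain ⟨v, hv⟩ := Function.ne_iff.1 hne
  have h₁ := d.sum_rank_add_card_le hT hT' h
  have h₂ : 0 < (Finset.univ.filter fun v => T v ≠ T' v).card :=
    Finset.card_pos.2 ⟨v, by simpa using hv⟩
  omega

variable {S : Finset V} {T₀ : V → Budget} (h₀ : ∀ v, T₀ v ≤ G.top)
  (hbot : ∀ v ∉ S, ∀ x ≤ G.top, r (T₀ v) x)
include h₀ hbot

theorem iter_succ (n : ℕ) (v : V) : r (G.iter S T₀ n v) (G.iter S T₀ (n + 1) v) := by
  by_cases hv : v ∈ S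
  · simpa only [iter_of_mem _ _ hv] using d.refl _
  · induction n generalizing v with
    | zero => exact hbot v hv _ (G.iter_le_top h₀ _ _)
    | succ n ih =>
      rw [G.iter_succ_of_notMem _ hv, G.iter_succ_of_notMem _ hv]
      refine d.avg v fun u => ?_
      by_cases hu : u ∈ S
      · simpa only [iter_of_mem _ _ hu] using d.refl _
      · exact ih u hu

theorem limit_of_notMem {v : V} (hv : v ∉ S) : G.limit S T₀ v = G.avg (G.limit S T₀) v := by
  -- The total rank drops whenever the table changes, so the iteration repeats within the number of
  -- rounds that defines `limit`, and is constant from then on.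
  obtain ⟨n, hn, e⟩ := exists_succ_eq_of_potential (G.iter S T₀)
    (fun n => ∑ v, rank (G.iter S T₀ n v)) (d.sum_rank_le h₀)
    fun n => d.sum_rank_lt (G.iter_le_top h₀ _) (G.iter_le_top h₀ _) (d.iter_succ h₀ hbot n)
  have stable : ∀ m, n ≤ m → G.iter S T₀ m = G.iter S T₀ n := by
    intro m hm
    induction m, hm using Nat.le_induction with
    | base => rfl
    | succ m _ ih =>
      rw [e]
      simp only [iter, ih]
  have hlim : G.limit S T₀ = G.iter S T₀ n := stable _ hn
  rw [hlim, ← G.iter_succ_of_notMem T₀ hv]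
  exact congrFun e v

theorem iter_limit (n : ℕ) (v : V) : r (G.iter S T₀ n v) (G.limit S T₀ v) := by
  induction n generalizing v with
  | zero =>
    by_cases hv : v ∈ S
    · rw [limit_of_mem _ _ hv]
      exact d.refl _
    · exact hbot v hv _ (G.iter_le_top h₀ _ _)
  | succ n ih =>
    by_cases hv : v ∈ S
    · rw [limit_of_mem _ _ hv, iter_of_mem _ _ hv]
      exact d.refl _
    · rw [d.limit_of_notMem h₀ hbot hv, iter_succ_of_notMem _ _ hv]
      exact d.avg v ih

omit h₀ in
/-- The limit is the first solution of the averaging equations. -/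
theorem limit_eq_of_avg {T : V → Budget} (hT : ∀ v, T v ≤ G.top) (hS : ∀ v ∈ S, T v = T₀ v)
    (hav : ∀ v ∉ S, T v = G.avg T v) (hlim : ∀ v, r (T v) (G.limit S T₀ v)) :
    T = G.limit S T₀ := by
  have key : ∀ n v, r (G.iter S T₀ n v) (T v) := by
    intro n
    induction n with
    | zero =>
      intro v
      by_cases hv : v ∈ S
      · rw [hS v hv]
        exact d.refl _
      · exact hbot v hv _ (hT v)
    | succ n ih =>
      intro v
      by_cases hv : v ∈ S
      · rw [hS v hv, iter_of_mem _ _ hv]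
        exact d.refl _
      · rw [hav v hv, iter_succ_of_notMem _ _ hv]
        exact d.avg v ih
  exact funext fun v => d.antisymm (hlim v) (key _ v)

/-- A phase of the algorithm that starts with a queue `q` of dirty vertices and a table `T` between
`T₀` and the limit ends with the limit. -/
theorem phase_of_invariant {order : List V} (hnd : order.Nodup) (hmem : ∀ v, v ∈ order)
    (mk : (V → Budget) → List V → State V)
    (hmk : ∀ T u q, G.step order (mk T (u :: q)) =
      mk (G.relax S T u) (q ++ changed order T (G.relax S T u)))
    (n : ℕ) (T : V → Budget) (q : List V) (hn : q.length + ∑ v, rank (T v) ≤ n)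
    (hT : ∀ v, T v ≤ G.top) (hS : ∀ v ∈ S, T v = T₀ v)
    (hlim : ∀ v, r (T v) (G.limit S T₀ v)) (hav : ∀ v ∉ S, r (T v) (G.avg T v))
    (hq : ∀ v ∉ S, T v ≠ G.avg T v → ∃ u ∈ q, (v, u) ∈ G.E) :
    ∃ t ≤ n, (G.step order)^[t] (mk T q) = mk (G.limit S T₀) [] := by
  induction n generalizing T q with
  | zero =>
    obtain rfl : q = [] := List.length_eq_zero_iff.1 (by omega)
    rw [d.limit_eq_of_avg hbot hT hS (fun v hv => by simpa using hq v hv) hlim]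
    exact ⟨0, le_rfl, rfl⟩
  | succ n ih =>
    rcases q with _ | ⟨u, q⟩
    · rw [d.limit_eq_of_avg hbot hT hS (fun v hv => by simpa using hq v hv) hlim]
      exact ⟨0, Nat.zero_le _, rfl⟩
    set T' := G.relax S T u with hT'
    have hval : ∀ w, T' w = T w ∨ (w ∉ S ∧ T' w = G.avg T w) := by
      intro w
      simp only [hT', relax]
      split_ifs with h <;> simp_all
    have hup : ∀ w, r (T w) (T' w) := by
      intro w
      rcases hval w with h | ⟨hw, h⟩ <;> rw [h]
      exacts [d.refl _, hav w hw]
    have htop : ∀ w, T' w ≤ G.top := by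
      intro w
      rcases hval w with h | ⟨hw, h⟩ <;> rw [h]
      exacts [hT w, G.avg_le hT]
    have hlen : (changed order T T').length = (Finset.univ.filter fun v => T v ≠ T' v).card := by
      rw [changed, ← List.toFinset_card_of_nodup (hnd.filter _)]
      congr 1
      ext v
      simp [hmem]
    -- Queue length plus total rank drops at every step: one vertex is removed, and each vertex
    -- appended has lost rank.
    have hsum := d.sum_rank_add_card_le hT htop hup
    obtain ⟨t, ht, e⟩ := ih T' (q ++ changed order T T')
      (by rw [List.length_append, hlen]; rw [List.length_cons] at hn; omega) htop
      (fun v hv => by rw [← hS v hv]; exact (hval v).resolve_right fun h => h.1 hv)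
      (fun v => by
        rcases hval v with h | ⟨hv, h⟩ <;> rw [h]
        · exact hlim v
        · rw [d.limit_of_notMem h₀ hbot hv]
          exact d.avg v hlim)
      (fun v hv => by
        rcases hval v with h | ⟨_, h⟩ <;> rw [h]
        · exact d.trans (hav v hv) (d.avg v hup)
        · exact d.avg v hup)
      (fun v hv hne => by
        -- The queue invariant survives. If a neighbour of `v` changed, it has been appended.
        -- Otherwise the average at `v` is unchanged, so `v` is not a predecessor of `u` (it would
        -- have been corrected), and its old witness in the queue is not `u`.
        by_cases hch : ∃ w, (v, w) ∈ G.E ∧ T w ≠ T' w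
        · obtain ⟨w, hw, hne'⟩ := hch
          exact ⟨w, by simp [changed, hmem, hne'], hw⟩
        · push Not at hch
          rw [← G.avg_congr hch] at hne
          have hvu : (v, u) ∉ G.E := fun h => hne (by simp [hT', relax, hv, h])
          obtain ⟨w, hw, hvw⟩ := hq v hv (by simpa [hT', relax, hvu] using hne)
          rcases List.mem_cons.1 hw with rfl | hw
          · exact absurd hvw hvu
          · exact ⟨w, by simp [hw], hvw⟩)
    exact ⟨t + 1, by omega, by rw [Function.iterate_succ_apply, hmk, e]⟩

theorem phase {order : List V} (hnd : order.Nodup) (hmem : ∀ v, v ∈ order)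
    (mk : (V → Budget) → List V → State V)
    (hmk : ∀ T u q, G.step order (mk T (u :: q)) =
      mk (G.relax S T u) (q ++ changed order T (G.relax S T u))) :
    ∃ t ≤ Fintype.card V * (2 * G.k + 3),
      (G.step order)^[t] (mk T₀ order) = mk (G.limit S T₀) [] := by
  have hlen : order.length = Fintype.card V := by
    rw [← List.toFinset_card_of_nodup hnd, ← Finset.card_univ]
    congr 1
    ext v
    simp [hmem]
  refine d.phase_of_invariant h₀ hbot hnd hmem mk hmk _ T₀ order ?_ h₀ (fun _ _ => rfl)
    (d.iter_limit h₀ hbot 0) (fun v hv => hbot v hv _ (G.avg_le h₀)) fun v _ _ => ?_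
  · have := d.sum_rank_le h₀
    rw [hlen]
    nlinarith
  · obtain ⟨u, hu⟩ := G.exists_edge v
    exact ⟨u, hmem u, hu⟩

end Direction

end

section

/-! ### Paths in which levels decrease -/

/-- The values reached after the drops are distinct and below `φ 0`. -/
theorem encard_le_of_antitone {A : Set ℕ} {φ : ℕ → ℕ} (h : Antitone φ)
    (hA : ∀ t ∈ A, φ (t + 1) < φ t) : A.encard ≤ φ 0 := by
  have key : A.encard ≤ (Set.Iio (φ 0)).encard := by
    refine Set.encard_le_encard_of_injOn (f := fun t => φ (t + 1))
      (fun t ht => (hA t ht).trans_le (h (Nat.zero_le t))) fun s hs t ht e => ?_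
    by_contra hne
    simp only at e
    rcases lt_or_gt_of_ne hne with hlt | hlt
    · have h₁ := hA t ht
      have h₂ := h (Nat.succ_le_of_lt hlt)
      simp only [Nat.succ_eq_add_one] at h₂
      omega
    · have h₁ := hA s hs
      have h₂ := h (Nat.succ_le_of_lt hlt)
      simp only [Nat.succ_eq_add_one] at h₂
      omega
  simpa [Set.encard_eq_coe_toFinset_card] using key

theorem finite_setOf_of_antitone {α : Type*} [LinearOrder α] [WellFoundedLT α] {φ : ℕ → α}
    (h : Antitone φ) : {t | φ (t + 1) < φ t}.Finite := by
  obtain ⟨n, hn⟩ := WellFoundedGT.monotone_chain_condition (α := αᵒᵈ)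
    ⟨fun t => OrderDual.toDual (φ t), h⟩
  refine (Set.finite_Iio n).subset fun t ht => ?_
  by_contra hle
  have h₁ := hn t (by simpa using hle)
  have h₂ := hn (t + 1) (by simp at hle; omega)
  have h₃ : φ t = φ (t + 1) := OrderDual.toDual.injective (h₁.symm.trans h₂)
  exact (ne_of_gt ht) h₃

variable {V : Type*} (G : BuchiGame V)

theorem exists_exit_of_mem_coBuchi {π : ℕ → V} (h : π ∈ G.CoBuchi) (h₀ : π 0 ∈ G.F) :
    ∃ j, π j ∈ G.F ∧ π (j + 1) ∉ G.F := by
  by_contra! hne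
  have hall : ∀ j, π j ∈ G.F := fun j => Nat.rec h₀ (fun j ih => hne j ih) j
  exact Set.infinite_univ (h.subset fun j _ => hall j)

/-- The level is the number of times that the path may still be in a visit to `F`, counting a
current visit; the rank bounds the time left in that visit. -/
theorem mem_safe_of_levels [DecidableEq V] {π : ℕ → V} {lev rank : ℕ → ℕ} {i : ℕ} (h₀ : lev 0 ≤ i)
    (hout : ∀ t, π t ∉ G.F → lev (t + 1) ≤ lev t) (hpos : ∀ t, π t ∈ G.F → 1 ≤ lev t)
    (hexit : ∀ t, π t ∈ G.F → π (t + 1) ∉ G.F → lev (t + 1) < lev t)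
    (hin : ∀ t, π t ∈ G.F → π (t + 1) ∈ G.F →
      lev (t + 1) < lev t ∨ lev (t + 1) = lev t ∧ rank (t + 1) < rank t) :
    π ∈ G.Safe i := by
  have hco : π ∈ G.CoBuchi := by
    -- Doubling the level makes room for the bit "outside `F`", so that entering `F` is a strict
    -- drop even at an unchanged level, and leaving it, which costs a level, still is one.
    let φ : ℕ → ℕ ×ₗ ℕ := fun t =>
      toLex (2 * lev t + (if π t ∈ G.F then 0 else 1), if π t ∈ G.F then rank t else 0)
    have hstrict : ∀ t, π t ∈ G.F → φ (t + 1) < φ t := by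
      intro t ht
      simp only [φ, Prod.Lex.toLex_lt_toLex, ht, if_true]
      by_cases ht' : π (t + 1) ∈ G.F
      · have := hin t ht ht'
        simp only [ht', if_true]
        omega
      · have := hexit t ht ht'
        simp only [ht', if_false]
        omega
    have hanti : Antitone φ := by
      refine antitone_nat_of_succ_le fun t => ?_
      by_cases ht : π t ∈ G.F
      · exact (hstrict t ht).le
      · have := hout t ht
        simp only [φ, Prod.Lex.toLex_le_toLex, ht, if_false]
        by_cases ht' : π (t + 1) ∈ G.F
        · simp only [ht', if_true]
          omega
        · simp only [ht', if_false]
          omega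
    exact (finite_setOf_of_antitone hanti).subset hstrict
  have hent : (G.entries π).encard ≤ (lev 0 - if π 0 ∈ G.F then 1 else 0 : ℕ) := by
    -- Discounting the current visit gives a quantity that never increases and drops exactly where
    -- entries need it.
    refine encard_le_of_antitone (φ := fun t => lev t - if π t ∈ G.F then 1 else 0)
      (antitone_nat_of_succ_le fun t => ?_) fun t ⟨ht, ht'⟩ => ?_
    · by_cases ht : π t ∈ G.F
      · have h₁ := hpos t ht
        by_cases ht' : π (t + 1) ∈ G.F
        · have := hin t ht ht'
          simp only [ht, ht', if_true]
          omega
        · have := hexit t ht ht'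
          simp only [ht, ht', if_true, if_false]
          omega
      · have := hout t ht
        simp only [ht, if_false]
        omega
    · have h₁ := hout t ht
      have h₂ := hpos _ ht'
      simp only [ht, ht', if_true, if_false]
      omega
  refine ⟨hco, ?_⟩
  by_cases hF : π 0 ∈ G.F
  · refine .inr ⟨hF, G.exists_exit_of_mem_coBuchi hco hF, ?_⟩
    rw [if_pos hF] at hent
    have h₁ := hpos 0 hF
    calc (G.entries π).encard + 1 ≤ (lev 0 - 1 : ℕ) + 1 := by gcongr
      _ = (lev 0 : ℕ∞) := by
        norm_cast
        omega
      _ ≤ i := by exact_mod_cast h₀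
  · refine .inl ⟨hF, ?_⟩
    rw [if_neg hF] at hent
    exact hent.trans (by exact_mod_cast h₀)

/-! ### Suffixes of paths -/

theorem coBuchi_suffix {π : ℕ → V} (h : π ∈ G.CoBuchi) (s : ℕ) :
    (fun j => π (j + s)) ∈ G.CoBuchi :=
  Set.Finite.preimage (f := (· + s)) (s := {j | π j ∈ G.F}) (add_left_injective s).injOn h

theorem image_entries_suffix_subset (π : ℕ → V) (s : ℕ) :
    (fun j => j + s) '' G.entries (fun j => π (j + s)) ⊆ G.entries π := by
  rintro _ ⟨j, hj, rfl⟩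
  simpa [entries, add_right_comm] using hj

theorem encard_entries_suffix_le (π : ℕ → V) (s : ℕ) :
    (G.entries fun j => π (j + s)).encard ≤ (G.entries π).encard := by
  rw [← (add_left_injective s).encard_image]
  exact Set.encard_le_encard (G.image_entries_suffix_subset π s)

theorem encard_entries_suffix_add_one_le {π : ℕ → V} {r s : ℕ} (hrs : r < s)
    (hr : r ∈ G.entries π) :
    (G.entries fun j => π (j + s)).encard + 1 ≤ (G.entries π).encard := by
  rw [← (add_left_injective s).encard_image, ← Set.encard_insert_of_notMem (a := r)]
  · exact Set.encard_le_encard (Set.insert_subset hr (G.image_entries_suffix_subset π s))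
  · rintro ⟨j, -, e⟩
    simp only at e
    omega

/-! ### Paths that return to `F` until the level is used up -/

/-- `Bad l t`: at time `t`, the objective `Safe l` is lost. -/
structure Losing (π : ℕ → V) (i : ℕ) (Bad : ℕ → ℕ → Prop) : Prop where
  stay : ∀ l < i, ∀ t, π t ∈ G.F → Bad (l + 1) t → π (t + 1) ∈ G.F → Bad (l + 1) (t + 1)
  exit : ∀ l < i, ∀ t, π t ∈ G.F → Bad (l + 1) t → π (t + 1) ∉ G.F → Bad l (t + 1)
  enter : ∀ l ≤ i, ∀ t, π t ∉ G.F → Bad l t →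
    ∃ s ≥ t, π s ∉ G.F ∧ π (s + 1) ∈ G.F ∧ Bad l (s + 1)

variable {G} {π : ℕ → V} {i : ℕ} {Bad : ℕ → ℕ → Prop}

theorem Losing.suffix (h : G.Losing π i Bad) (s : ℕ) :
    G.Losing (fun j => π (j + s)) i fun l j => Bad l (j + s) where
  stay l hl t h₁ h₂ h₃ := by
    rw [add_right_comm] at h₃ ⊢
    exact h.stay l hl _ h₁ h₂ h₃
  exit l hl t h₁ h₂ h₃ := by
    rw [add_right_comm] at h₃ ⊢
    exact h.exit l hl _ h₁ h₂ h₃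
  enter l hl t h₁ h₂ := by
    obtain ⟨r, hr, h₃, h₄, h₅⟩ := h.enter l hl _ h₁ h₂
    obtain ⟨r, rfl⟩ := Nat.exists_eq_add_of_le' ((Nat.le_add_left s t).trans hr)
    refine ⟨r, by omega, h₃, ?_, ?_⟩ <;> rw [add_right_comm] <;> assumption

/-- From `F`, the first exit reduces to level `l` on the suffix. From outside, the forced entry uses
up one permitted entry and reduces to a start in `F` at the same level. Passing to suffixes is why
`π` and `Bad` are generalized. -/
theorem Losing.notMem_safe (l : ℕ) (hl : l ≤ i) : ∀ {π : ℕ → V} {Bad : ℕ → ℕ → Prop},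
    G.Losing π i Bad → Bad l 0 → π ∉ G.Safe l := by
  induction l with
  | zero =>
    intro π Bad h hbad ⟨hco, hs⟩
    rcases hs with ⟨h₀, hs⟩ | ⟨-, -, hs⟩
    · obtain ⟨s, -, h₁, h₂, -⟩ := h.enter 0 hl 0 h₀ hbad
      have h₃ : s ∈ G.entries π := ⟨h₁, h₂⟩
      simp only [Nat.cast_zero, nonpos_iff_eq_zero, Set.encard_eq_zero] at hs
      simp [hs] at h₃
    · simp at hs
  | succ l ih =>
    have inF : ∀ {π : ℕ → V} {Bad : ℕ → ℕ → Prop}, G.Losing π i Bad → Bad (l + 1) 0 →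
        π 0 ∈ G.F → π ∉ G.Safe (l + 1) := by
      intro π Bad h hbad h₀ ⟨hco, hs⟩
      rcases hs with ⟨h₀', -⟩ | ⟨-, hex, hs⟩
      · exact h₀' h₀
      classical
      have hmin := fun j hj => Nat.find_min hex (m := j) hj
      obtain ⟨h₁, h₂⟩ := Nat.find_spec hex
      generalize Nat.find hex = j at *
      have hstay : ∀ r ≤ j, π r ∈ G.F ∧ Bad (l + 1) r := by
        intro r
        induction r with
        | zero => exact fun _ => ⟨h₀, hbad⟩
        | succ r ihr =>
          intro hr
          obtain ⟨h₃, h₄⟩ := ihr (by omega)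
          have h₅ : π (r + 1) ∈ G.F := by
            by_contra h₅
            exact hmin r (by omega) ⟨h₃, h₅⟩
          exact ⟨h₅, h.stay l hl r h₃ h₄ h₅⟩
      have hbad' := h.exit l hl j h₁ (hstay j le_rfl).2 h₂
      refine ih (by omega) (h.suffix (j + 1)) (by simpa using hbad')
        ⟨G.coBuchi_suffix hco _, .inl ⟨by simpa using h₂, ?_⟩⟩
      refine (G.encard_entries_suffix_le π _).trans ?_
      rw [Nat.cast_add, Nat.cast_one] at hs
      exact (ENat.add_le_add_iff_right ENat.one_ne_top).1 hs
    intro π Bad h hbad hs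
    by_cases h₀ : π 0 ∈ G.F
    · exact inF h hbad h₀ hs
    obtain ⟨s, -, h₁, h₂, h₃⟩ := h.enter _ hl 0 h₀ hbad
    have hco := G.coBuchi_suffix hs.1 (s + 1)
    have h₂' : (fun j => π (j + (s + 1))) 0 ∈ G.F := by simpa using h₂
    refine inF (h.suffix (s + 1)) (by simpa using h₃) h₂' ⟨hco, .inr ⟨h₂',
      G.exists_exit_of_mem_coBuchi hco h₂', ?_⟩⟩
    exact (G.encard_entries_suffix_add_one_le (Nat.lt_succ_self s) ⟨h₁, h₂⟩).trans
      (hs.2.resolve_right fun h => h₀ h.1).2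

/-- `hdown` restores the level that an exit costs, so level `l + 1` stays bad at ever later visits
to `F`. -/
theorem Losing.notMem_coBuchi {l : ℕ} (hl : l < i) (h : G.Losing π i Bad)
    (hdown : ∀ t, Bad l t → Bad (l + 1) t) (hbad : Bad (l + 1) 0) : π ∉ G.CoBuchi := by
  have hnext : ∀ t, Bad (l + 1) t → ∃ s > t, π s ∈ G.F ∧ Bad (l + 1) s := by
    have hout : ∀ t, π t ∉ G.F → Bad (l + 1) t → ∃ s > t, π s ∈ G.F ∧ Bad (l + 1) s := by
      intro t ht hb
      obtain ⟨s, hs, -, h₁, h₂⟩ := h.enter _ hl t ht hb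
      exact ⟨s + 1, by omega, h₁, h₂⟩
    intro t hb
    by_cases ht : π t ∈ G.F
    · by_cases ht' : π (t + 1) ∈ G.F
      · exact ⟨t + 1, by omega, ht', h.stay l hl t ht hb ht'⟩
      · obtain ⟨s, hs, h₁⟩ := hout _ ht' (hdown _ (h.exit l hl t ht hb ht'))
        exact ⟨s, by omega, h₁⟩
    · exact hout t ht hb
  have hinf : ∀ n, ∃ s > n, π s ∈ G.F ∧ Bad (l + 1) s := by
    intro n
    induction n with
    | zero => exact hnext 0 hbad
    | succ n ih =>
      obtain ⟨s, hs, -, h₂⟩ := ih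
      obtain ⟨r, hr, h₃⟩ := hnext s h₂
      exact ⟨r, by omega, h₃⟩
  intro hco
  refine Set.infinite_of_not_bddAbove ?_ hco
  rintro ⟨n, hn⟩
  obtain ⟨s, hs, h₁, -⟩ := hinf n
  exact absurd (hn h₁) (by omega)

end

section

variable {V : Type*} [DecidableEq V] (G : BuchiGame V)

/-! ### The threshold tables -/

/-- The initial table of an avoid phase. -/
def avoidTable (fr : V → Budget) : V → Budget := fun v => if v ∈ G.F then fr v else ⟨0, false⟩

/-- The initial table of a reach phase. -/
def reachTable (fr : V → Budget) : V → Budget := fun v => if v ∈ G.F then G.top else fr v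

theorem zero_le_budget (b : Budget) : (⟨0, false⟩ : Budget) ≤ b := by
  simp [Budget.le_iff, Budget.code]

theorem avoidTable_le_top {fr : V → Budget} (h : ∀ v, fr v ≤ G.top) (v : V) :
    G.avoidTable fr v ≤ G.top := by
  unfold avoidTable
  split_ifs
  exacts [h v, zero_le_budget _]

theorem reachTable_le_top {fr : V → Budget} (h : ∀ v, fr v ≤ G.top) (v : V) :
    G.reachTable fr v ≤ G.top := by
  unfold reachTable
  split_ifs
  exacts [le_rfl, h v]

theorem avoidTable_bot (fr : V → Budget) : ∀ v ∉ G.F, ∀ x ≤ G.top, G.avoidTable fr v ≤ x :=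
  fun v hv x _ => by simpa [avoidTable, hv] using zero_le_budget x

theorem avoidTable_mono {fr fr' : V → Budget} (h : ∀ v, fr v ≤ fr' v) (v : V) :
    G.avoidTable fr v ≤ G.avoidTable fr' v := by
  unfold avoidTable
  split_ifs
  exacts [h v, le_rfl]

theorem reachTable_mono {fr fr' : V → Budget} (h : ∀ v, fr v ≤ fr' v) (v : V) :
    G.reachTable fr v ≤ G.reachTable fr' v := by
  unfold reachTable
  split_ifs
  exacts [le_rfl, h v]

variable [Fintype V]

/-- The table that the `i`-th avoid phase starts from; on `F` these are the target budgets. -/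
def targets : ℕ → V → Budget
  | 0 => fun _ => G.top
  | i + 1 => G.limit G.Fᶜ (G.reachTable (G.limit G.F (G.avoidTable (targets i))))

/-- The threshold for `Safe i`. -/
def thr (i : ℕ) : V → Budget := G.limit G.F (G.avoidTable (G.targets i))

/-- The `n`-th approximation of `thr i` from below. -/
def avoidIter (i n : ℕ) : V → Budget := G.iter G.F (G.avoidTable (G.targets i)) n

/-- The `n`-th approximation of `targets (i + 1)` from above. -/
def reachIter (i n : ℕ) : V → Budget := G.iter G.Fᶜ (G.reachTable (G.thr i)) n

theorem targets_succ (i : ℕ) : G.targets (i + 1) = G.limit G.Fᶜ (G.reachTable (G.thr i)) := rfl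

theorem reachTable_bot (fr : V → Budget) : ∀ v ∉ G.Fᶜ, ∀ x ≤ G.top, G.reachTable fr v ≥ x :=
  fun v hv x hx => by simpa [reachTable, show v ∈ G.F by simpa using hv] using hx

theorem targets_le_top (i : ℕ) (v : V) : G.targets i v ≤ G.top := by
  induction i generalizing v with
  | zero => exact le_rfl
  | succ i ih =>
    exact G.iter_le_top (G.reachTable_le_top (G.iter_le_top (G.avoidTable_le_top ih) _)) _ v

theorem avoidIter_le_top (i n : ℕ) (v : V) : G.avoidIter i n v ≤ G.top :=
  G.iter_le_top (G.avoidTable_le_top (G.targets_le_top i)) n v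

theorem thr_le_top (i : ℕ) (v : V) : G.thr i v ≤ G.top := G.avoidIter_le_top i _ v

theorem avoidIter_le_thr (i n : ℕ) (v : V) : G.avoidIter i n v ≤ G.thr i v :=
  G.direction_le.iter_limit (G.avoidTable_le_top (G.targets_le_top i)) (G.avoidTable_bot _) n v

theorem targets_le_reachIter (i n : ℕ) (v : V) : G.targets (i + 1) v ≤ G.reachIter i n v :=
  G.direction_ge.iter_limit (G.reachTable_le_top (G.thr_le_top i)) (G.reachTable_bot _) n v

variable {G}

theorem thr_of_mem (i : ℕ) {v : V} (hv : v ∈ G.F) : G.thr i v = G.targets i v := by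
  simp [thr, limit_of_mem _ _ hv, avoidTable, hv]

theorem thr_of_notMem (i : ℕ) {v : V} (hv : v ∉ G.F) : G.thr i v = G.avg (G.thr i) v :=
  G.direction_le.limit_of_notMem (G.avoidTable_le_top (G.targets_le_top i)) (G.avoidTable_bot _) hv

theorem targets_succ_of_mem (i : ℕ) {v : V} (hv : v ∈ G.F) :
    G.targets (i + 1) v = G.avg (G.targets (i + 1)) v :=
  G.direction_ge.limit_of_notMem (G.reachTable_le_top (G.thr_le_top i)) (G.reachTable_bot _)
    (by simpa using hv)

theorem targets_succ_of_notMem (i : ℕ) {v : V} (hv : v ∉ G.F) :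
    G.targets (i + 1) v = G.thr i v := by
  rw [targets_succ, limit_of_mem _ _ (by simpa using hv)]
  simp [reachTable, hv]

theorem reachIter_of_notMem (i n : ℕ) {v : V} (hv : v ∉ G.F) : G.reachIter i n v = G.thr i v := by
  rw [reachIter, iter_of_mem _ _ (by simpa using hv)]
  simp [reachTable, hv]

variable (G)

theorem targets_succ_le (i : ℕ) (v : V) : G.targets (i + 1) v ≤ G.targets i v := by
  induction i generalizing v with
  | zero => exact G.targets_le_top 1 v
  | succ i ih =>
    exact G.iter_mono (G.reachTable_mono (G.iter_mono (G.avoidTable_mono ih) _)) _ v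

theorem thr_antitone (v : V) : Antitone fun i => G.thr i v :=
  antitone_nat_of_succ_le fun i => G.iter_mono (G.avoidTable_mono (G.targets_succ_le i)) _ v

/-- The sum of the codes is at most `|V| (2k + 2)` and drops whenever the table changes. -/
theorem exists_thr_eq_succ : ∃ n ≤ Fintype.card V * (2 * G.k + 2), G.thr n = G.thr (n + 1) :=
  exists_succ_eq_of_potential G.thr (fun n => ∑ v, (G.thr n v).code)
    (G.direction_ge.sum_rank_le (G.thr_le_top 0)) fun n =>
    G.direction_ge.sum_rank_lt (G.thr_le_top n) (G.thr_le_top (n + 1))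
      fun v => G.thr_antitone v (Nat.le_succ n)

variable {G}

theorem thr_eq_of_le {n m : ℕ} (h : G.thr n = G.thr (n + 1)) (hnm : n ≤ m) :
    G.thr m = G.thr n := by
  induction m, hnm using Nat.le_induction with
  | base => rfl
  | succ m _ ih => rw [h, thr, thr, targets_succ, targets_succ, ih]

/-- `thr n` is averaged outside `F`, and `targets (n + 1)` inside; at a fixed point the two tables
coincide. -/
theorem hasAverageProperty_thr {n : ℕ} (h : G.thr n = G.thr (n + 1)) :
    G.HasAverageProperty (G.thr n) := by
  have e : G.targets (n + 1) = G.thr n := by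
    funext v
    by_cases hv : v ∈ G.F
    · rw [h, thr_of_mem _ hv]
    · exact targets_succ_of_notMem n hv
  intro v
  by_cases hv : v ∈ G.F
  · have := targets_succ_of_mem n hv
    rwa [e] at this
  · exact thr_of_notMem n hv

/-! ### Strategies for the bounded objectives -/

/-- Where the budget suffices for some `Safe l`, Player 1 can make progress. -/
theorem exists_strategy_safe : ∃ f, G.Legal₁ f ∧ ∀ g, G.Legal₂ g → ∀ c : Config V,
    c.budget.val ≤ G.k → ∀ i, G.thr i c.vertex ≤ c.budget → play f g c ∈ G.Safe i := by
  -- The default `sInf ∅ = 0` occurs only where no level (or rank) suffices; `hlev` and `hrank`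
  -- always start from a witness. Nothing here depends on `i`, so one strategy serves all levels.
  let lev : Config V → ℕ := fun c => sInf {l | G.thr l c.vertex ≤ c.budget}
  let rank : Config V → ℕ := fun c => sInf {n | G.reachIter (lev c - 1) n c.vertex ≤ c.budget}
  have hlev : ∀ c l, G.thr l c.vertex ≤ c.budget →
      lev c ≤ l ∧ G.thr (lev c) c.vertex ≤ c.budget :=
    fun c l h => ⟨Nat.sInf_le h, Nat.sInf_mem (s := {l | G.thr l c.vertex ≤ c.budget}) ⟨l, h⟩⟩
  have hrank : ∀ c n, G.reachIter (lev c - 1) n c.vertex ≤ c.budget →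
      rank c ≤ n ∧ G.reachIter (lev c - 1) (rank c) c.vertex ≤ c.budget :=
    fun c n h => ⟨Nat.sInf_le h,
      Nat.sInf_mem (s := {n | G.reachIter (lev c - 1) n c.vertex ≤ c.budget}) ⟨n, h⟩⟩
  obtain ⟨f, hf, H⟩ := G.exists_strategy₁ fun c =>
    if c.vertex ∈ G.F then G.reachIter (lev c - 1) (rank c - 1) else G.thr (lev c)
  refine ⟨f, hf, fun g hg c hc i hi => ?_⟩
  replace H := H g hg c
  have hk := G.history_budget_le (f := f) hg hc
  obtain ⟨q, hq⟩ : ∃ q : ℕ → Config V, ∀ t, (history f g c t).2 = q t := ⟨_, fun _ => rfl⟩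
  have hplay : play f g c = fun t => (q t).vertex := funext fun t => by rw [play, hq]
  have hq₀ : q 0 = c := (hq 0).symm
  simp only [hq] at H hk
  rw [hplay]
  clear_value lev rank
  have stepF : ∀ t, (q t).vertex ∈ G.F → G.thr (lev (q t)) (q t).vertex ≤ (q t).budget →
      ∃ m n, lev (q t) = m + 1 ∧ rank (q t) = n + 1 ∧
        G.reachIter m n (q (t + 1)).vertex ≤ (q (t + 1)).budget := by
    intro t ht hw
    have hlt : (q t).budget < G.top := G.lt_top_iff.2 (hk t)
    -- Level `0` and, below, rank `0` are impossible in `F`: both tables equal `k + 1` there, which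
    -- no budget attains.
    rcases hL : lev (q t) with _ | m
    · rw [hL, thr_of_mem _ ht] at hw
      exact absurd hlt hw.not_gt
    have hr := hrank (q t)
    rw [hL, thr_of_mem _ ht] at hw
    simp only [hL, Nat.add_sub_cancel] at hr
    have hw' := (hr _ hw).2
    rcases hR : rank (q t) with _ | n
    · rw [hR] at hw'
      simp only [reachIter, iter, reachTable, ht, if_true] at hw'
      exact absurd hlt hw'.not_gt
    refine ⟨m, n, rfl, rfl, ?_⟩
    have := H t
    simp only [ht, if_true, hL, hR, Nat.add_sub_cancel] at this
    apply this
    rwa [hR, reachIter, iter_succ_of_notMem _ _ (by simpa using ht)] at hw'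
  have stepN : ∀ t, (q t).vertex ∉ G.F → G.thr (lev (q t)) (q t).vertex ≤ (q t).budget →
      G.thr (lev (q t)) (q (t + 1)).vertex ≤ (q (t + 1)).budget := by
    intro t ht hw
    have := H t
    simp only [ht, if_false] at this
    exact this (by rwa [← thr_of_notMem _ ht])
  -- If the token remains in `F`, meeting any reach iterate for level `m` still suffices for `Safe
  -- (m + 1)`, so the level does not rise.
  have hreach : ∀ m n v, v ∈ G.F → G.thr (m + 1) v ≤ G.reachIter m n v := fun m n v hv => by
    rw [thr_of_mem _ hv]
    exact G.targets_le_reachIter m n v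
  have hw : ∀ t, G.thr (lev (q t)) (q t).vertex ≤ (q t).budget := by
    intro t
    induction t with
    | zero =>
      rw [hq₀]
      exact (hlev _ _ hi).2
    | succ t ih =>
      by_cases ht : (q t).vertex ∈ G.F
      · obtain ⟨m, n, -, -, h⟩ := stepF t ht ih
        by_cases ht' : (q (t + 1)).vertex ∈ G.F
        · exact (hlev _ (m + 1) ((hreach m n _ ht').trans h)).2
        · rw [reachIter_of_notMem _ _ ht'] at h
          exact (hlev _ _ h).2
      · exact (hlev _ _ (stepN t ht ih)).2
  refine G.mem_safe_of_levels (lev := fun t => lev (q t)) (rank := fun t => rank (q t))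
    ?_ ?_ ?_ ?_ ?_
  · simp only [hq₀]
    exact (hlev _ _ hi).1
  · exact fun t ht => (hlev _ _ (stepN t ht (hw t))).1
  · intro t ht
    obtain ⟨m, n, hm, -, -⟩ := stepF t ht (hw t)
    simp only [hm]
    omega
  · intro t ht ht'
    obtain ⟨m, n, hm, -, h⟩ := stepF t ht (hw t)
    rw [reachIter_of_notMem _ _ ht'] at h
    have := (hlev _ _ h).1
    simp only [hm]
    omega
  · intro t ht ht'
    obtain ⟨m, n, hm, hn, h⟩ := stepF t ht (hw t)
    have h₁ := (hlev _ (m + 1) ((hreach m n _ ht').trans h)).1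
    simp only [hm, hn]
    by_cases he : lev (q (t + 1)) = m + 1
    · have h₂ := (hrank (q (t + 1)) n (by simpa only [he, Nat.add_sub_cancel] using h)).1
      omega
    · omega

/-- Where the budget does not suffice for `Safe l`, Player 2 can spoil it. -/
theorem exists_strategy_losing (i : ℕ) : ∃ g, G.Legal₂ g ∧ ∀ f, G.Legal₁ f → ∀ c : Config V,
    G.Losing (play f g c) i fun l t =>
      (history f g c t).2.budget < G.thr l (history f g c t).2.vertex := by
  -- Since `thr` decreases in the level, the largest level is the strongest claim of Player 2. The
  -- cap `i` is needed because the budget may lie below `thr l` for every `l`.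
  let lev : Config V → ℕ := fun c => Nat.findGreatest (fun l => c.budget < G.thr l c.vertex) i
  let rank : Config V → ℕ := fun c => sInf {n | c.budget < G.avoidIter (lev c) n c.vertex}
  have hlev : ∀ c, ∀ l ≤ i, c.budget < G.thr l c.vertex →
      l ≤ lev c ∧ c.budget < G.thr (lev c) c.vertex := fun c l hl h =>
    ⟨Nat.le_findGreatest hl h,
      Nat.findGreatest_spec (P := fun l => c.budget < G.thr l c.vertex) hl h⟩
  have hlev_le : ∀ c, lev c ≤ i := fun c => Nat.findGreatest_le i
  have hrank : ∀ c n, c.budget < G.avoidIter (lev c) n c.vertex →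
      rank c ≤ n ∧ c.budget < G.avoidIter (lev c) (rank c) c.vertex := fun c n h =>
    ⟨Nat.sInf_le h, Nat.sInf_mem (s := {n | c.budget < G.avoidIter (lev c) n c.vertex}) ⟨n, h⟩⟩
  obtain ⟨g, hg, H⟩ := G.exists_strategy₂
    (fun c => if c.vertex ∈ G.F then G.targets (lev c) else G.avoidIter (lev c) (rank c - 1))
    (fun c u => by split_ifs; exacts [G.targets_le_top _ _, G.avoidIter_le_top _ _ _])
  refine ⟨g, hg, fun f hf c => ?_⟩
  replace H := H f hf c
  obtain ⟨q, hq⟩ : ∃ q : ℕ → Config V, ∀ t, (history f g c t).2 = q t := ⟨_, fun _ => rfl⟩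
  have hplay : play f g c = fun t => (q t).vertex := funext fun t => by rw [play, hq]
  simp only [hq] at H ⊢
  rw [hplay]
  clear_value lev rank
  have stepF : ∀ t l, l < i → (q t).vertex ∈ G.F → (q t).budget < G.thr (l + 1) (q t).vertex →
      ∃ m ≥ l, (q (t + 1)).budget < G.targets (m + 1) (q (t + 1)).vertex := by
    intro t l hl ht hb
    obtain ⟨h₁, h₂⟩ := hlev (q t) (l + 1) hl hb
    obtain ⟨m, hm⟩ := Nat.exists_eq_add_of_le' ((Nat.le_add_left 1 l).trans h₁)
    refine ⟨m, by omega, ?_⟩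
    have := H t
    simp only [ht, if_true, hm] at this
    apply this
    rwa [hm, thr_of_mem _ ht, targets_succ_of_mem _ ht] at h₂
  refine ⟨?_, ?_, ?_⟩
  · intro l hl t ht hb ht'
    obtain ⟨m, hm, h⟩ := stepF t l hl ht hb
    rw [← thr_of_mem _ ht'] at h
    exact h.trans_le (G.thr_antitone _ (by omega))
  · intro l hl t ht hb ht'
    obtain ⟨m, hm, h⟩ := stepF t l hl ht hb
    rw [targets_succ_of_notMem _ ht'] at h
    exact h.trans_le (G.thr_antitone _ hm)
  · intro l hl
    -- Outside `F` either the level rises towards the cap `i`, or it stays and the rank falls. Rank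
    -- `0` is impossible because the avoid iteration starts from `0` outside `F`, so `F` is entered.
    have key : ∀ p : ℕ ×ₗ ℕ, ∀ t, toLex (i - lev (q t), rank (q t)) = p → (q t).vertex ∉ G.F →
        (q t).budget < G.thr l (q t).vertex → ∃ s ≥ t, (q s).vertex ∉ G.F ∧
          (q (s + 1)).vertex ∈ G.F ∧ (q (s + 1)).budget < G.thr l (q (s + 1)).vertex := by
      intro p
      induction p using WellFoundedLT.induction with
      | ind p ih =>
        rintro t rfl ht hb
        obtain ⟨h₁, h₂⟩ := hlev (q t) l hl hb
        obtain ⟨-, h₃⟩ := hrank (q t) _ h₂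
        rcases hR : rank (q t) with _ | n
        · rw [hR] at h₃
          simp only [avoidIter, iter, avoidTable, ht, if_false] at h₃
          exact absurd h₃ (zero_le_budget _).not_gt
        rw [hR, avoidIter, iter_succ_of_notMem _ _ ht] at h₃
        have h₄ := H t
        simp only [ht, if_false, hR, Nat.add_sub_cancel] at h₄
        replace h₄ := h₄ h₃
        have h₅ := h₄.trans_le (G.avoidIter_le_thr _ _ _)
        have h₆ := h₅.trans_le (G.thr_antitone _ h₁)
        by_cases ht' : (q (t + 1)).vertex ∈ G.F
        · exact ⟨t, le_rfl, ht, ht', h₆⟩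
        · have hlt : toLex (i - lev (q (t + 1)), rank (q (t + 1))) <
              toLex (i - lev (q t), n + 1) := by
            rw [Prod.Lex.toLex_lt_toLex]
            have h₇ := (hlev (q (t + 1)) _ (hlev_le (q t)) h₅).1
            have h₈ := hlev_le (q (t + 1))
            by_cases he : lev (q (t + 1)) = lev (q t)
            · exact .inr ⟨by simp only [he],
                Nat.lt_succ_of_le (hrank (q (t + 1)) n (by rwa [he])).1⟩
            · refine .inl ?_
              simp only
              omega
          obtain ⟨s, hs, h⟩ := ih _ (hR ▸ hlt) (t + 1) rfl ht' h₆
          exact ⟨s, by omega, h⟩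
    exact fun t ht hb => key _ t rfl ht hb

theorem isThreshold_thr_safe (i : ℕ) : G.IsThreshold (G.Safe i) (G.thr i) := by
  refine ⟨G.thr_le_top i, fun v B hB => ⟨fun h => ?_, fun h => ?_⟩⟩
  · obtain ⟨f, hf, H⟩ := exists_strategy_safe (G := G)
    exact ⟨f, hf, fun g hg => H g hg _ hB i h⟩
  · obtain ⟨g, hg, H⟩ := exists_strategy_losing (G := G) i
    exact ⟨g, hg, fun f hf => Losing.notMem_safe i le_rfl (H f hf _) h⟩

/-- Player 2 plays the spoiling strategy with cap `n + 1`; the equality of the two top levels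
provides the hypothesis `hdown` of `Losing.notMem_coBuchi`. -/
theorem isThreshold_thr_coBuchi {n : ℕ} (hn : G.thr n = G.thr (n + 1)) :
    G.IsThreshold G.CoBuchi (G.thr n) := by
  refine ⟨G.thr_le_top n, fun v B hB => ⟨fun h => ?_, fun h => ?_⟩⟩
  · obtain ⟨f, hf, H⟩ := exists_strategy_safe (G := G)
    exact ⟨f, hf, fun g hg => (H g hg _ hB n h).1⟩
  · obtain ⟨g, hg, H⟩ := exists_strategy_losing (G := G) (n + 1)
    rw [hn] at h
    exact ⟨g, hg, fun f hf => (H f hf _).notMem_coBuchi (Nat.lt_succ_self n)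
      (fun t => by rw [hn]; exact id) h⟩

/-! ### The algorithm -/

variable {order : List V} (hnd : order.Nodup) (hmem : ∀ v, v ∈ order)
include hnd hmem

theorem exists_avoid_phase (prev : Option (V → Budget)) (i : ℕ) :
    ∃ t ≤ Fintype.card V * (2 * G.k + 3),
      (G.step order)^[t] (G.startAvoid order prev (G.targets i)) = .avoid prev (G.thr i) [] :=
  G.direction_le.phase (G.avoidTable_le_top (G.targets_le_top i)) (G.avoidTable_bot _) hnd hmem
    (State.avoid prev) fun _ _ _ => rfl

theorem exists_reach_phase (i : ℕ) :
    ∃ t ≤ Fintype.card V * (2 * G.k + 3),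
      (G.step order)^[t] (G.startReach order (G.thr i)) =
        .reach (G.thr i) (G.targets (i + 1)) [] :=
  G.direction_ge.phase (G.reachTable_le_top (G.thr_le_top i)) (G.reachTable_bot _) hnd hmem
    (State.reach (G.thr i)) fun _ _ _ => rfl

/-- As long as no two consecutive thresholds coincide, the algorithm goes on to the next one. -/
theorem exists_stateAfter_eq_avoid (i : ℕ) (hne : ∀ j, j + 1 < i → G.thr j ≠ G.thr (j + 1)) :
    ∃ t ≤ i * (2 * (Fintype.card V * (2 * G.k + 3)) + 2) + Fintype.card V * (2 * G.k + 3),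
      G.stateAfter order t =
        .avoid (if i = 0 then none else some (G.thr (i - 1))) (G.thr i) [] := by
  induction i with
  | zero =>
    obtain ⟨t, ht, e⟩ := exists_avoid_phase (G := G) hnd hmem none 0
    exact ⟨t, by simpa using ht, e⟩
  | succ i ih =>
    obtain ⟨t₁, ht₁, e₁⟩ := ih fun j hj => hne j (by omega)
    obtain ⟨t₂, ht₂, e₂⟩ := exists_reach_phase (G := G) hnd hmem i
    obtain ⟨t₃, ht₃, e₃⟩ := exists_avoid_phase (G := G) hnd hmem (some (G.thr i)) (i + 1)
    have hs₁ : G.step order (G.stateAfter order t₁) = G.startReach order (G.thr i) := by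
      rw [e₁, step, if_neg]
      rcases i with _ | i
      · simp
      · simpa using hne i (by omega)
    have hs₂ : G.step order (.reach (G.thr i) (G.targets (i + 1)) []) =
        G.startAvoid order (some (G.thr i)) (G.targets (i + 1)) := rfl
    -- One round consists of a reach phase, an avoid phase, and the two passages before them.
    refine ⟨t₃ + (1 + (t₂ + (1 + t₁))), ?_, ?_⟩
    · rw [Nat.add_mul]
      omega
    · rw [stateAfter] at hs₁ ⊢
      rw [Function.iterate_add_apply, Function.iterate_add_apply _ 1,
        Function.iterate_add_apply _ t₂, Function.iterate_add_apply _ 1, Function.iterate_one, hs₁,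
        e₂, hs₂, e₃]
      simp

/-- The algorithm stops after avoid phase `m + 1` for the first fixed point `m`; the tables are
constant from there on, so its output is `thr n` for any other fixed point `n`. -/
theorem exists_stateAfter_eq_halted [Nonempty V] {n : ℕ} (hn : G.thr n = G.thr (n + 1)) :
    ∃ t ≤ 66 * (Fintype.card V * max G.k 1) ^ 2, G.stateAfter order t = .halted (G.thr n) := by
  classical
  have hex : ∃ m, G.thr m = G.thr (m + 1) := ⟨n, hn⟩
  obtain ⟨m₀, hm₀, h₀⟩ := G.exists_thr_eq_succ
  have hm := Nat.find_spec hex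
  have hle : Nat.find hex ≤ Fintype.card V * (2 * G.k + 2) := (Nat.find_min' hex h₀).trans hm₀
  have hnm : Nat.find hex ≤ n := Nat.find_min' hex hn
  have hmin := fun j hj => Nat.find_min hex (m := j) hj
  generalize Nat.find hex = m at *
  obtain ⟨t, ht, e⟩ := exists_stateAfter_eq_avoid (G := G) hnd hmem (m + 1)
    fun j hj => hmin j (by omega)
  refine ⟨1 + t, ?_, ?_⟩
  · have hcard : 1 ≤ Fintype.card V := Fintype.card_pos
    have hK : 1 ≤ max G.k 1 := le_max_right _ _
    have hkK : G.k ≤ max G.k 1 := le_max_left _ _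
    generalize max G.k 1 = K at *
    have hX : 1 ≤ Fintype.card V * K := Nat.mul_pos hcard hK
    have hP : Fintype.card V * (2 * G.k + 3) ≤ 5 * (Fintype.card V * K) := by
      rw [mul_left_comm]
      exact Nat.mul_le_mul_left _ (by omega)
    have hM : m ≤ 4 * (Fintype.card V * K) := by
      rw [mul_left_comm]
      exact hle.trans (Nat.mul_le_mul_left _ (by omega))
    generalize Fintype.card V * K = X at *
    generalize Fintype.card V * (2 * G.k + 3) = P at *
    -- With `X = |V| max(k, 1)` one has `P ≤ 5X` and `m ≤ 4X`. The total is `40X² + 23X + 3`, and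
    -- `40 + 23 + 3 = 66` as `X ≥ 1`.
    calc 1 + t ≤ 1 + ((m + 1) * (2 * P + 2) + P) := by omega
      _ ≤ 1 + ((4 * X + 1) * (2 * (5 * X) + 2) + 5 * X) := by gcongr
      _ ≤ 66 * X ^ 2 := by nlinarith
  · rw [stateAfter] at e ⊢
    rw [Function.iterate_add_apply, Function.iterate_one, e, step, if_pos (by simp [hm]), ← hm,
      thr_eq_of_le hm hnm]

end

end BuchiGame

end Bidding

theorem mainTheorem4 :
    ∃ C : ℕ, ∀ (V : Type*) [Fintype V] [DecidableEq V] [Nonempty V] (G : Bidding.BuchiGame V),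
      -- the threshold budgets for the bounded objectives and for the co-Büchi objective exist
      (∀ i : ℕ, ∃! T : V → Bidding.Budget, G.IsThreshold (G.Safe i) T) ∧
      (∃! T : V → Bidding.Budget, G.IsThreshold G.CoBuchi T) ∧
      ∀ Th : ℕ → V → Bidding.Budget, (∀ i, G.IsThreshold (G.Safe i) (Th i)) →
        -- they are non-increasing and reach a fixed point
        (∀ i v, Th (i + 1) v ≤ Th i v) ∧
        (∃ n, Th n = Th (n + 1)) ∧
        ∀ n, Th n = Th (n + 1) →
          -- a fixed point is the co-Büchi threshold, satisfies the average property,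
          G.IsThreshold G.CoBuchi (Th n) ∧
          G.HasAverageProperty (Th n) ∧
          -- and the algorithm outputs it within `C (|V| k)²` steps
          ∀ order : List V, order.Nodup → (∀ v, v ∈ order) →
            ∃ t ≤ C * (Fintype.card V * max G.k 1) ^ 2,
              G.stateAfter order t = .halted (Th n) := by
  refine ⟨66, fun V _ _ _ G => ?_⟩
  obtain ⟨n, -, hn⟩ := G.exists_thr_eq_succ
  refine ⟨fun i => ⟨G.thr i, Bidding.BuchiGame.isThreshold_thr_safe i,
    fun T hT => hT.unique _ (Bidding.BuchiGame.isThreshold_thr_safe i)⟩,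
    ⟨G.thr n, Bidding.BuchiGame.isThreshold_thr_coBuchi hn,
      fun T hT => hT.unique _ (Bidding.BuchiGame.isThreshold_thr_coBuchi hn)⟩, fun Th hTh => ?_⟩
  obtain rfl : Th = G.thr :=
    funext fun i => (hTh i).unique _ (Bidding.BuchiGame.isThreshold_thr_safe i)
  exact ⟨fun i v => G.thr_antitone v (Nat.le_succ i), ⟨n, hn⟩, fun n hn =>
    ⟨Bidding.BuchiGame.isThreshold_thr_coBuchi hn, Bidding.BuchiGame.hasAverageProperty_thr hn,
      fun order hnd hmem => Bidding.BuchiGame.exists_stateAfter_eq_halted hnd hmem hn⟩⟩
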